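/- Let $n\ge 1$ and $r=4k+2$ with $k\ge 0$. Let $G_{r,n}=\mathbb Z_r\wr S_n$ be the group of pairs $\pi=(\vec z,\tau)$, $\vec z\in\mathbb Z_r^n$, $\tau\in S_n$, with $(\vec z,\tau)(\vec z',\tau')=((z_i+z'_{\tau^{-1}(i)})_i,\ \tau\tau')$. Write $z_i(\pi)=z_i$ (the color of the digit $i$, represented in $\{0,\dots,r-1\}$) and $|\pi|=(\vec 0,\tau)$. Let $s_0$ be the element with $z_1=1$, all other colors $0$ and trivial permutation, and let $s_i=(\vec 0,(i\ i{+}1))$ for $1\le i\le n-1$. Let $A_{r,n}$ be the kernel of the homomorphism $\varphi:G_{r,n}\to\{\pm1\}$ with $\varphi(s_i)=-1$ for all $0\le i\le n-1$. Put $a_0=s_0^2$, $a_i=s_0^{r/2}s_i$ for $1\le i\le n-1$, and $\mathcal A=\{a_0,a_1,a_1^{-1},a_2,\dots,a_{n-1}\}$ (so $\mathcal A=\{a_0\}$ if $n=1$). For $\pi\in A_{r,n}$ let $\ell_{\mathcal A}(\pi)$ be the least number of factors in an expression of $\pi$ as a product of elements of $\mathcal A$. For $0\le a<r$ let $a\oslash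 2\in\{0,\dots,\frac r2-1\}$ be the residue modulo $\frac r2$ of $\frac a2$ if $a$ is even and of $\frac{a+r/2}{2}$ if $a$ is odd. Let $p:A_{r,n}\to G_{r/2,n}$ keep $\tau$ and replace each color $z_i$ by $z_i\oslash 2$. Let $s:G_{r/2,n}\to A_{r,n}$ keep $\tau$, replace each color $z_i$, represented in $\{0,\dots,\frac r2-1\}$, by $2z_i$ modulo $r$, and, if the permutation $\tau$ has an odd number of inversions, moreover add $\frac r2$ to the color of the digit $1$. Finally let $\mathrm{tinv}(\pi)$ (the number of absolute transparent inversions) be the number of pairs $(i,j)$ of digits with $z_i(\pi)=\frac r2$, $i>j$ and $\tau^{-1}(i)<\tau^{-1}(j)$. Then every element of $A_{r,n}$ is a product of elements of $\mathcal A$ (so that $\ell_{\mathcal A}$ is defined on all of $A_{r,n}$), and for every $\pi\in A_{r,n}$ the fibral length $\ell_F(\pi)=\ell_{\mathcal A}(\pi)-\ell_{\mathcal A}(s(p(\pi)))$ satisfies $$\ell_F(\pi)=2\sum_{\{i\,:\,z_i(\pi)=r/2\}}(i-1)\;-\;2\,\mathrm{tinv}(\pi).$$ -/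

import Mathlib

open Equiv

/-- The group `G_{r,n} = ℤ_r ≀ S_n` of colored permutations of `n` digits with `r` colors.
An element is a pair `(z, τ)`; `z i` is the color of the digit `i`.
The digit `i : Fin n` stands for the digit `i + 1` of `{1, …, n}`. As a map,
`(z, τ)` sends the (uncolored) digit `i` to `τ i` with the color `z (τ i)`. -/
@[ext]
structure ColoredPerm (r n : ℕ) where
  /-- `z i` is the color of the digit `i`. -/
  z : Fin n → ZMod r
  /-- the underlying permutation -/
  τ : Perm (Fin n)

namespace ColoredPerm

variable {r n : ℕ}

instance : Mul (ColoredPerm r n) :=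
  ⟨fun a b => ⟨fun i => a.z i + b.z (a.τ⁻¹ i), a.τ * b.τ⟩⟩

instance : One (ColoredPerm r n) := ⟨⟨fun _ => 0, 1⟩⟩

instance : Inv (ColoredPerm r n) := ⟨fun a => ⟨fun i => -a.z (a.τ i), a.τ⁻¹⟩⟩

@[simp] theorem mul_z (a b : ColoredPerm r n) (i : Fin n) :
    (a * b).z i = a.z i + b.z (a.τ⁻¹ i) := rfl
@[simp] theorem mul_τ (a b : ColoredPerm r n) : (a * b).τ = a.τ * b.τ := rfl
@[simp] theorem one_z (i : Fin n) : (1 : ColoredPerm r n).z i = 0 := rfl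
@[simp] theorem one_τ : (1 : ColoredPerm r n).τ = 1 := rfl
@[simp] theorem inv_z (a : ColoredPerm r n) (i : Fin n) : (a⁻¹).z i = -a.z (a.τ i) := rfl
@[simp] theorem inv_τ (a : ColoredPerm r n) : (a⁻¹).τ = a.τ⁻¹ := rfl

instance : Group (ColoredPerm r n) :=
  Group.ofLeftAxioms
    (fun a b c => by
      ext i
      · simp [add_assoc, mul_inv_rev]
      · simp [mul_assoc])
    (fun a => by ext i <;> simp)
    (fun a => by ext i <;> simp)

/-- `|π| = (0, τ)`. -/
def abs (π : ColoredPerm r n) : ColoredPerm r n := ⟨fun _ => 0, π.τ⟩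

/-- The value of `π` on the digit `i` (a digit together with its color): the `i`-th entry of
the window notation. -/
def window (π : ColoredPerm r n) (i : Fin n) : Fin n × ZMod r := (π.τ i, π.z (π.τ i))

/-- The length order
`n^{[r-1]} < ⋯ < n^{[1]} < ⋯ < 1^{[r-1]} < ⋯ < 1^{[1]} < 1 < ⋯ < n` on the colored digits. -/
def LengthLT (a b : Fin n × ZMod r) : Prop :=
  (a.2 ≠ 0 ∧ b.2 = 0) ∨
  (a.2 = 0 ∧ b.2 = 0 ∧ a.1 < b.1) ∨
  (a.2 ≠ 0 ∧ b.2 ≠ 0 ∧ (b.1 < a.1 ∨ (a.1 = b.1 ∧ b.2.val < a.2.val)))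

open scoped Classical in
/-- The inversion number, `inv π = |{(i, j) : i < j, π i > π j}|` for the length order. -/
noncomputable def invNumber (π : ColoredPerm r n) : ℕ :=
  (Finset.univ.filter fun q : Fin n × Fin n =>
    q.1 < q.2 ∧ LengthLT (π.window q.2) (π.window q.1)).card

/-- The generator `s_0`, which adds one color to the first digit. -/
def s₀ : ColoredPerm r n := ⟨fun j => if (j : ℕ) = 0 then 1 else 0, 1⟩

/-- The generators `s_0, s_1, …, s_{n-1}`: for `i ≥ 1`, `s_i` exchanges the digits `i` and
`i + 1` (that is, the elements `i - 1` and `i` of `Fin n`). -/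
def s (i : Fin n) : ColoredPerm r n :=
  if (i : ℕ) = 0 then s₀
  else ⟨fun _ => 0, swap ⟨(i : ℕ) - 1, lt_of_le_of_lt (Nat.sub_le _ _) i.isLt⟩ i⟩

theorem neg_one_pow_val_add (hr : Even r) (a b : ZMod r) :
    (-1 : ℤˣ) ^ (a + b).val = (-1) ^ a.val * (-1) ^ b.val := by
  rw [← pow_add]
  rcases Nat.eq_zero_or_pos r with rfl | hpos
  · have key : ∀ x y : ℤ, Even (Int.natAbs (x + y)) ↔ Even (Int.natAbs x + Int.natAbs y) := by
      intro x y
      rw [Int.natAbs_even, Nat.even_add, Int.natAbs_even, Int.natAbs_even, Int.even_add]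
    exact neg_one_pow_congr (key a b)
  · have : NeZero r := ⟨hpos.ne'⟩
    rw [ZMod.val_add]
    refine neg_one_pow_congr ?_
    rw [Nat.even_iff, Nat.even_iff, Nat.mod_mod_of_dvd _ hr.two_dvd]

/-- The character `φ : G_{r,n} → {1, -1}` (for even `r`), determined by `φ(s_i) = -1` for all
`0 ≤ i ≤ n - 1`, see `altChar_s`. -/
def altChar (n : ℕ) (hr : Even r) : ColoredPerm r n →* ℤˣ where
  toFun π := (∏ i, (-1 : ℤˣ) ^ (π.z i).val) * Perm.sign π.τ
  map_one' := by simp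
  map_mul' a b := by
    have h : ∏ i, (-1 : ℤˣ) ^ (b.z (a.τ⁻¹ i)).val = ∏ i, (-1 : ℤˣ) ^ (b.z i).val :=
      Equiv.prod_comp a.τ⁻¹ fun i => (-1 : ℤˣ) ^ (b.z i).val
    simp only [mul_z, mul_τ, neg_one_pow_val_add hr, Finset.prod_mul_distrib, h,
      Perm.sign_mul]
    exact mul_mul_mul_comm _ _ _ _

theorem altChar_apply (hr : Even r) (π : ColoredPerm r n) :
    altChar n hr π = (∏ i, (-1 : ℤˣ) ^ (π.z i).val) * Perm.sign π.τ := rfl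

theorem altChar_s₀ (hn : 0 < n) (hr : Even r) : altChar n hr s₀ = -1 := by
  have h1 : (-1 : ℤˣ) ^ (1 : ZMod r).val = -1 := by
    rcases Nat.eq_zero_or_pos r with rfl | hpos
    · rfl
    · have : Fact (1 < r) := ⟨by obtain ⟨m, rfl⟩ := hr; omega⟩
      rw [ZMod.val_one, pow_one]
  rw [altChar_apply, Finset.prod_eq_single ⟨0, hn⟩]
  · simp [s₀, h1]
  · intro j _ hj
    have : (j : ℕ) ≠ 0 := fun h => hj (Fin.ext h)
    simp [s₀, this]
  · simp

theorem altChar_s (hr : Even r) (i : Fin n) : altChar n hr (s i) = -1 := by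
  unfold s
  split_ifs with h
  · exact altChar_s₀ i.pos hr
  · rw [altChar_apply]
    have hne : (⟨(i : ℕ) - 1, lt_of_le_of_lt (Nat.sub_le _ _) i.isLt⟩ : Fin n) ≠ i := by
      intro h'
      have := congrArg Fin.val h'
      simp only at this
      omega
    simp [Perm.sign_swap hne]

/-- The operation `a ⊘ 2` (with respect to `r`); `R_m(a) = a % m`. -/
def oslash (r a : ℕ) : ℕ :=
  if a % 2 = 0 then (a / 2) % (r / 2) else ((a + r / 2) / 2) % (r / 2)

theorem lengthLT_abs (π : ColoredPerm r n) (i j : Fin n) :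
    LengthLT (π.abs.window i) (π.abs.window j) ↔ π.τ i < π.τ j := by
  simp [LengthLT, window, abs]

theorem neg_one_pow_invNumber_abs (π : ColoredPerm r n) :
    (-1 : ℤˣ) ^ invNumber π.abs = Perm.sign π.τ := by
  classical
  rw [Perm.sign_eq_prod_prod_Ioi, invNumber]
  have : ∀ i : Fin n, ∀ j ∈ Finset.Ioi i, (if π.τ i < π.τ j then (1 : ℤˣ) else -1) =
      if π.τ j < π.τ i then -1 else 1 := by
    intro i j hj
    have hij : π.τ i ≠ π.τ j := fun h => (Finset.mem_Ioi.1 hj).ne (π.τ.injective h)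
    rcases lt_or_gt_of_ne hij with h | h
    · simp [h, h.not_gt]
    · simp [h, h.not_gt]
  rw [Finset.prod_congr rfl fun i _ => Finset.prod_congr rfl (this i)]
  have h2 : ∀ i : Fin n, ∏ j ∈ Finset.Ioi i, (if π.τ j < π.τ i then (-1 : ℤˣ) else 1) =
      ∏ j, if i < j ∧ π.τ j < π.τ i then (-1 : ℤˣ) else 1 := by
    intro i
    rw [← Finset.prod_filter, ← Finset.prod_filter]
    congr 1
    ext j
    simp
  rw [Finset.prod_congr rfl fun i _ => h2 i, ← Fintype.prod_prod_type'
    (f := fun i j : Fin n => if i < j ∧ π.τ j < π.τ i then (-1 : ℤˣ) else 1),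
    ← Finset.prod_filter, Finset.prod_const]
  simp only [lengthLT_abs]

end ColoredPerm

open ColoredPerm

theorem even_of_mod_four {r : ℕ} (hr : r % 4 = 2) : Even r := Nat.even_iff.2 (by omega)

/-- The group `A_{r,n} = ker φ` of alternating colored permutations (for even `r`). -/
def alternatingColoredSubgroup (n : ℕ) {r : ℕ} (hr : Even r) : Subgroup (ColoredPerm r n) :=
  (altChar n hr).ker

/-- The group `A_{r,n}` in the case `r = 4k + 2`. -/
abbrev AltColoredPerm (n : ℕ) {r : ℕ} (hr : r % 4 = 2) : Type :=
  alternatingColoredSubgroup n (even_of_mod_four hr)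

/-- The length of `g` with respect to a set `S` of generators: the least length of a word with
letters in `S` whose product is `g`. -/
noncomputable def wordLength {G : Type*} [Group G] (S : Set G) (g : G) : ℕ :=
  sInf {u : ℕ | ∃ w : List G, (∀ x ∈ w, x ∈ S) ∧ w.prod = g ∧ w.length = u}

namespace AltColoredPerm

variable {r n : ℕ} (hr : r % 4 = 2)

/-- The elements `a_0 = s_0²` and `a_i = s_0^{r/2} s_i` (`1 ≤ i ≤ n - 1`) of `A_{r,n}`. -/
def a (i : Fin n) : AltColoredPerm n hr :=
  if (i : ℕ) = 0 then
    ⟨s₀ ^ 2, by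
      rw [alternatingColoredSubgroup, MonoidHom.mem_ker, map_pow, altChar_s₀ i.pos]; rfl⟩
  else
    ⟨s₀ ^ (r / 2) * s i, by
      have h : Odd (r / 2) := Nat.odd_iff.2 (by omega)
      rw [alternatingColoredSubgroup, MonoidHom.mem_ker, map_mul, map_pow, altChar_s₀ i.pos,
        altChar_s, h.neg_one_pow]
      rfl⟩

/-- The set of generators `𝒜 = {a_0, a_1, a_1⁻¹, a_2, …, a_{n-1}}` of `A_{r,n}`. -/
def generators (n : ℕ) : Set (AltColoredPerm n hr) :=
  {x | ∃ i : Fin n, x = a hr i} ∪ {x | ∃ i : Fin n, (i : ℕ) = 1 ∧ x = (a hr i)⁻¹}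

/-- The covering map `p : A_{r,n} → G_{r/2,n}`, which applies `⊘ 2` to the color of each
digit. -/
def p (π : AltColoredPerm n hr) : ColoredPerm (r / 2) n :=
  ⟨fun i => (oslash r (π.1.z i).val : ZMod (r / 2)), π.1.τ⟩

open scoped Classical in
/-- The underlying colored permutation of `s(π)`: all colors are doubled modulo `r`,
and if `inv |π|` is odd then `r/2` is added to the color of the digit `1`. -/
noncomputable def sectionAux (r : ℕ) (π : ColoredPerm (r / 2) n) : ColoredPerm r n :=
  ⟨fun i => ((2 * (π.z i).val +
      if (i : ℕ) = 0 ∧ invNumber π.abs % 2 = 1 then r / 2 else 0 : ℕ) : ZMod r), π.τ⟩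

theorem neg_one_pow_val_natCast {r : ℕ} (hr : Even r) (m : ℕ) :
    (-1 : ℤˣ) ^ (m : ZMod r).val = (-1) ^ m := by
  refine neg_one_pow_congr ?_
  rw [ZMod.val_natCast, Nat.even_iff, Nat.even_iff, Nat.mod_mod_of_dvd _ hr.two_dvd]

theorem altChar_sectionAux (hr : r % 4 = 2) (π : ColoredPerm (r / 2) n) :
    altChar n (even_of_mod_four hr) (sectionAux r π) = 1 := by
  classical
  have hodd : Odd (r / 2) := Nat.odd_iff.2 (by omega)
  rw [altChar_apply]
  have hτ : (sectionAux r π).τ = π.τ := rfl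
  rw [hτ, ← neg_one_pow_invNumber_abs π]
  have hz : ∀ i, (-1 : ℤˣ) ^ ((sectionAux r π).z i).val =
      if (i : ℕ) = 0 ∧ invNumber π.abs % 2 = 1 then -1 else 1 := by
    intro i
    simp only [sectionAux]
    rw [neg_one_pow_val_natCast (even_of_mod_four hr), pow_add, pow_mul]
    split_ifs <;> simp [hodd.neg_one_pow]
  rw [Finset.prod_congr rfl fun i _ => hz i]
  rcases Nat.mod_two_eq_zero_or_one (invNumber π.abs) with h | h
  · simp [h, (Nat.even_iff.2 h).neg_one_pow]
  · rcases Nat.eq_zero_or_pos n with rfl | hn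
    · simp [invNumber] at h
    · rw [Finset.prod_eq_single ⟨0, hn⟩]
      · simp [h, (Nat.odd_iff.2 h).neg_one_pow]
      · intro j _ hj
        have : (j : ℕ) ≠ 0 := fun h' => hj (Fin.ext h')
        simp [this]
      · simp

/-- The section `s : G_{r/2,n} → A_{r,n}` of the covering map `p`. -/
noncomputable def sec (π : ColoredPerm (r / 2) n) : AltColoredPerm n hr :=
  ⟨sectionAux r π, by
    rw [alternatingColoredSubgroup, MonoidHom.mem_ker]; exact altChar_sectionAux hr π⟩

/-- The length function `ℓ_𝒜` of `A_{r,n}` with respect to the generators `𝒜`. -/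
noncomputable def length (π : AltColoredPerm n hr) : ℕ := wordLength (generators hr n) π

/-- The fibral length `ℓ_F(π) = ℓ_𝒜(π) - ℓ_𝒜(s(p(π)))`. -/
noncomputable def fibralLength (π : AltColoredPerm n hr) : ℤ :=
  (length hr π : ℤ) - (length hr (sec hr (p hr π)) : ℤ)

/-- The digits `i` with `z_i(π) = r/2`. -/
def halfColored (π : AltColoredPerm n hr) : Finset (Fin n) :=
  Finset.univ.filter fun i => π.1.z i = ((r / 2 : ℕ) : ZMod r)

/-- The set of absolute transparent inversions of `π`: the pairs `(i, j)` of digits with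
`z_i(π) = r/2`, `i > j` and `|π|⁻¹(i) < |π|⁻¹(j)`. -/
def Tinv (π : AltColoredPerm n hr) : Finset (Fin n × Fin n) :=
  Finset.univ.filter fun q =>
    π.1.z q.1 = ((r / 2 : ℕ) : ZMod r) ∧ q.2 < q.1 ∧ π.1.τ⁻¹ q.1 < π.1.τ⁻¹ q.2

/-- `tinv π = |Tinv π|`. -/
def tinv (π : AltColoredPerm n hr) : ℕ := (Tinv hr π).card

end AltColoredPerm

/-! The proof rests on a closed formula for `ℓ_𝒜`, namely `altLength`: the sum of the reduced colors
`z_i ⊘ 2`, plus a cost for each pair of digits `j < i`, equal to `1` if `i` stands before `j` and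
otherwise to `2` or `0` according to whether `i` is colored. The factor `a_0` moves the reduced
color of the first entry cyclically by one. A factor `a_i^{±1}` with `i ≥ 1` swaps adjacent entries
and adds `r/2` to a digit that stands first before or after; reduced colors do not see `r/2`, and a
first digit has cost `1` against all smaller ones whatever its color, so only the swapped pair
changes its cost, by `±1`. Thus a generator raises `altLength` by at most one (`altLength_mul_le`),
and only the identity has no descent (`eq_one_of_no_descent`).

The composite `s ∘ p` keeps `τ` and all reduced colors, and turns color `r/2` into `0` except
perhaps at digit `1`, which is never the larger of a pair. So the fibral length is `2` for each pair
`j < i` with `z_i = r/2` and `j` before `i`: all `i - 1` smaller digits, less the transparent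
inversions. -/

/-! ### Word length from descents -/

/-- If a function `L` vanishes at `1` and can be decreased by one with a letter of `S` at every
`g ≠ 1`, then every `g` has a word of length `L g`. -/
theorem exists_word_of_descent {G : Type*} [Group G] {S : Set G} {L : G → ℕ} (h1 : L 1 = 0)
    (hd : ∀ g, g ≠ 1 → ∃ s ∈ S, L (g * s⁻¹) + 1 = L g) (g : G) :
    ∃ w : List G, (∀ x ∈ w, x ∈ S) ∧ w.prod = g ∧ w.length = L g := by
  induction h : L g generalizing g with
  | zero =>
    have : g = 1 := by
      by_contra hg
      obtain ⟨s, -, hs⟩ := hd g hg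
      omega
    exact ⟨[], by simp, by simp [this], rfl⟩
  | succ k ih =>
    obtain ⟨s, hs, hL⟩ := hd g (by rintro rfl; omega)
    obtain ⟨w, hw, hp, hl⟩ := ih (g * s⁻¹) (by omega)
    refine ⟨w ++ [s], ?_, by simp [hp], by simp [hl]⟩
    simp only [List.mem_append, List.mem_singleton]
    rintro x (hx | rfl)
    exacts [hw x hx, hs]

theorem le_length_of_word {G : Type*} [Group G] {S : Set G} {L : G → ℕ} (h1 : L 1 = 0)
    (hle : ∀ g, ∀ s ∈ S, L (g * s) ≤ L g + 1) (w : List G) (hw : ∀ x ∈ w, x ∈ S) :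
    L w.prod ≤ w.length := by
  induction w using List.reverseRecOn with
  | nil => simp [h1]
  | append_singleton w s ih =>
    have h := hle w.prod s (hw s (by simp))
    have h' := ih fun x hx => hw x (by simp [hx])
    simp only [List.prod_append, List.prod_singleton, List.length_append, List.length_singleton]
    omega

/-- Descents give a word of length `L g`; since a letter raises `L` by at most one, no word is
shorter. -/
theorem wordLength_eq_of_descent {G : Type*} [Group G] {S : Set G} {L : G → ℕ} (h1 : L 1 = 0)
    (hle : ∀ g, ∀ s ∈ S, L (g * s) ≤ L g + 1)
    (hd : ∀ g, g ≠ 1 → ∃ s ∈ S, L (g * s⁻¹) + 1 = L g) (g : G) : wordLength S g = L g := by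
  refine le_antisymm (Nat.sInf_le (exists_word_of_descent h1 hd g)) ?_
  refine le_csInf ⟨_, exists_word_of_descent h1 hd g⟩ ?_
  rintro _ ⟨w, hw, rfl, rfl⟩
  exact le_length_of_word h1 hle w hw

theorem closure_eq_top_of_descent {G : Type*} [Group G] {S : Set G} {L : G → ℕ} (h1 : L 1 = 0)
    (hd : ∀ g, g ≠ 1 → ∃ s ∈ S, L (g * s⁻¹) + 1 = L g) : Submonoid.closure S = ⊤ := by
  refine eq_top_iff.2 fun g _ => ?_
  obtain ⟨w, hw, rfl, -⟩ := exists_word_of_descent h1 hd g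
  exact Submonoid.list_prod_mem _ fun x hx => Submonoid.subset_closure (hw x hx)

theorem sum_add_eq_of_eq_off {ι : Type*} [Fintype ι] [DecidableEq ι] {f g : ι → ℕ} (a : ι)
    (h : ∀ i, i ≠ a → f i = g i) : ∑ i, f i + g a = ∑ i, g i + f a := by
  rw [← Finset.add_sum_erase _ f (Finset.mem_univ a), ← Finset.add_sum_erase _ g (Finset.mem_univ a),
    Finset.sum_congr rfl fun i hi => h i (Finset.ne_of_mem_erase hi)]
  ring

/-! ### The operation `⊘ 2` -/

theorem oslash_eq {r a : ℕ} (hr : r % 4 = 2) (ha : a < r) :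
    oslash r a = if a % 2 = 0 then a / 2 else
      if a < r / 2 then (a + r / 2) / 2 else (a - r / 2) / 2 := by
  unfold oslash
  split_ifs with h1 h2
  · exact Nat.mod_eq_of_lt (by omega)
  · exact Nat.mod_eq_of_lt (by omega)
  · rw [show (a + r / 2) / 2 = (a - r / 2) / 2 + r / 2 by omega, Nat.add_mod_right,
      Nat.mod_eq_of_lt (by omega)]

theorem oslash_lt {r : ℕ} (hr : r % 4 = 2) (a : ℕ) : oslash r a < r / 2 := by
  unfold oslash
  split_ifs <;> exact Nat.mod_lt _ (by omega)

theorem val_add_natCast {r : ℕ} [NeZero r] (x : ZMod r) {m : ℕ} (hm : m < r) :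
    (x + m).val = if x.val + m < r then x.val + m else x.val + m - r := by
  have hx := x.val_lt
  rw [ZMod.val_add, ZMod.val_cast_of_lt hm]
  split_ifs with h
  · exact Nat.mod_eq_of_lt h
  · rw [Nat.mod_eq_sub_mod (by omega), Nat.mod_eq_of_lt (by omega)]

/-- As `r/2` is odd, `⊘ 2` is halving in `ℤ/(r/2)`, so it only depends on the color modulo `r/2`. -/
theorem oslash_val_add_half {r : ℕ} (hr : r % 4 = 2) (x : ZMod r) :
    oslash r (x + (r / 2 : ℕ)).val = oslash r x.val := by
  have : NeZero r := ⟨by omega⟩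
  have hx := x.val_lt
  rw [oslash_eq hr (ZMod.val_lt _), oslash_eq hr hx, val_add_natCast x (by omega)]
  split_ifs <;> omega

theorem oslash_val_eq_zero_iff {r : ℕ} (hr : r % 4 = 2) (x : ZMod r) :
    oslash r x.val = 0 ↔ x = 0 ∨ x = (r / 2 : ℕ) := by
  have : NeZero r := ⟨by omega⟩
  have hx := x.val_lt
  rw [← (ZMod.val_injective r).eq_iff, ← (ZMod.val_injective r).eq_iff,
    ZMod.val_cast_of_lt (by omega), ZMod.val_zero, oslash_eq hr hx]
  split_ifs <;> omega

theorem oslash_val_add_two {r : ℕ} (hr : r % 4 = 2) (x : ZMod r) :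
    oslash r (x + 2).val = oslash r x.val + 1 ∨
      oslash r (x + 2).val = 0 ∧ oslash r x.val + 1 = r / 2 := by
  have : NeZero r := ⟨by omega⟩
  have hx := x.val_lt
  rcases Nat.lt_or_ge 2 r with h2 | h2
  · have h := val_add_natCast x (m := 2) h2
    rw [Nat.cast_ofNat] at h
    rw [oslash_eq hr (ZMod.val_lt _), oslash_eq hr hx, h]
    split_ifs <;> omega
  -- Here `r = 2`, and `0` is the only reduced color.
  · have h1 := oslash_lt hr x.val
    have h3 := oslash_lt hr (x + 2).val
    omega

theorem two_mul_half_cast {r : ℕ} (hr : r % 4 = 2) :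
    ((r / 2 : ℕ) : ZMod r) + (r / 2 : ℕ) = 0 := by
  rw [← Nat.cast_add, show r / 2 + r / 2 = r by omega, ZMod.natCast_self]

theorem neg_half_cast {r : ℕ} (hr : r % 4 = 2) :
    -((r / 2 : ℕ) : ZMod r) = (r / 2 : ℕ) :=
  neg_eq_of_add_eq_zero_left (two_mul_half_cast hr)

theorem oslash_two_mul {r c : ℕ} (hr : r % 4 = 2) (hc : c < r / 2) :
    oslash r ((2 * c : ℕ) : ZMod r).val = c := by
  rw [ZMod.val_cast_of_lt (by omega), oslash_eq hr (by omega)]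
  split_ifs <;> omega

/-! ### The length formula and its change under adjacent swaps -/

namespace ColoredPerm

variable {r n : ℕ}

/-- The sum of the reduced colors `z_i ⊘ 2`. -/
def colorLength (π : ColoredPerm r n) : ℕ := ∑ i, oslash r (π.z i).val

/-- The contribution of the pair `(i, j)` of digits to the length: for `j < i` it is `1` if `i`
stands before `j`, and otherwise `2` or `0`, according to whether `i` is colored. -/
def pairCost (π : ColoredPerm r n) (q : Fin n × Fin n) : ℕ :=
  if q.2 < q.1 then
    if π.τ⁻¹ q.1 < π.τ⁻¹ q.2 then 1 else if π.z q.1 = 0 then 0 else 2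
  else 0

def pairLength (π : ColoredPerm r n) : ℕ := ∑ q, π.pairCost q

/-- The closed formula for the length `ℓ_𝒜`. -/
def altLength (π : ColoredPerm r n) : ℕ := π.colorLength + π.pairLength

theorem altLength_one : (1 : ColoredPerm r n).altLength = 0 := by
  have h : ∀ q, (1 : ColoredPerm r n).pairCost q = 0 := by
    intro q
    unfold pairCost
    split_ifs with h1 h2 h3
    · exact absurd h1 (not_lt_of_gt (by simpa using h2))
    · rfl
    · exact absurd rfl h3
    · rfl
  simp [altLength, colorLength, pairLength, h, oslash]

theorem colorLength_eq_of_half (hr : r % 4 = 2) {π ρ : ColoredPerm r n}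
    (h : ∀ i, ρ.z i = π.z i ∨ ρ.z i = π.z i + (r / 2 : ℕ)) :
    ρ.colorLength = π.colorLength := by
  refine Finset.sum_congr rfl fun i _ => ?_
  rcases h i with h | h <;> rw [h]
  exact oslash_val_add_half hr _

/-- A digit that stands first precedes the other member of the pair, so its cost is `1` and its
color is irrelevant. -/
theorem pairCost_eq {π ρ : ColoredPerm r n} {q : Fin n × Fin n}
    (hτ : π.τ⁻¹ q.1 < π.τ⁻¹ q.2 ↔ ρ.τ⁻¹ q.1 < ρ.τ⁻¹ q.2)
    (hz : ρ.z q.1 = π.z q.1 ∨ (π.τ⁻¹ q.1 : ℕ) = 0 ∨ (ρ.τ⁻¹ q.1 : ℕ) = 0) :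
    π.pairCost q = ρ.pairCost q := by
  unfold pairCost
  by_cases h : q.2 < q.1
  · have key : (π.τ⁻¹ q.1 : ℕ) = 0 ∨ (ρ.τ⁻¹ q.1 : ℕ) = 0 → π.τ⁻¹ q.1 < π.τ⁻¹ q.2 := by
      rintro (h0 | h0)
      · have : π.τ⁻¹ q.1 ≠ π.τ⁻¹ q.2 := fun e => h.ne' (π.τ⁻¹.injective e)
        rw [Fin.lt_def]
        have := Fin.val_ne_of_ne this
        omega
      · have : ρ.τ⁻¹ q.1 ≠ ρ.τ⁻¹ q.2 := fun e => h.ne' (ρ.τ⁻¹.injective e)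
        rw [hτ, Fin.lt_def]
        have := Fin.val_ne_of_ne this
        omega
    rcases hz with hz | hz
    · simp only [hτ, hz]
    · simp only [← hτ, key hz, if_true]
  · simp [h]

theorem pairLength_eq {π ρ : ColoredPerm r n} (hτ : ρ.τ = π.τ)
    (hz : ∀ i, ρ.z i = π.z i ∨ (π.τ⁻¹ i : ℕ) = 0) : ρ.pairLength = π.pairLength :=
  Finset.sum_congr rfl fun q _ => (pairCost_eq (by rw [hτ]) ((hz q.1).imp_right Or.inl)).symm

theorem swap_lt_swap_iff {u v a b : Fin n} (huv : (u : ℕ) + 1 = v)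
    (h : ¬ (a = u ∧ b = v)) (h' : ¬ (a = v ∧ b = u)) :
    swap u v a < swap u v b ↔ a < b := by
  simp only [swap_apply_def, Fin.ext_iff, Fin.lt_def] at *
  split_ifs <;> omega

/-- An adjacent swap reverses the relative order of one pair of digits only. -/
theorem pairLength_add {π ρ : ColoredPerm r n} {u v : Fin n} (huv : (u : ℕ) + 1 = v)
    (hτ : ρ.τ = π.τ * swap u v)
    (hz : ∀ i, ρ.z i = π.z i ∨ (π.τ⁻¹ i : ℕ) = 0 ∨ (ρ.τ⁻¹ i : ℕ) = 0)
    (a : Fin n × Fin n) (ha : a.2 < a.1)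
    (ha' : a = (π.τ u, π.τ v) ∨ a = (π.τ v, π.τ u)) :
    ρ.pairLength + π.pairCost a = π.pairLength + ρ.pairCost a := by
  refine sum_add_eq_of_eq_off a fun q hq => ?_
  by_cases hq' : q.2 < q.1
  · refine (pairCost_eq ?_ (hz q.1)).symm
    rw [hτ, mul_inv_rev, swap_inv, Perm.mul_apply, Perm.mul_apply, swap_lt_swap_iff huv]
    · rintro ⟨h1, h2⟩
      rw [Perm.inv_eq_iff_eq] at h1 h2
      rcases ha' with rfl | rfl
      · exact hq (Prod.ext h1 h2)
      · simp only [h1, h2] at hq' ha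
        exact lt_asymm hq' ha
    · rintro ⟨h1, h2⟩
      rw [Perm.inv_eq_iff_eq] at h1 h2
      rcases ha' with rfl | rfl
      · simp only [h1, h2] at hq' ha
        exact lt_asymm hq' ha
      · exact hq (Prod.ext h1 h2)
  · simp [pairCost, hq']

theorem pairLength_of_lt {π ρ : ColoredPerm r n} {u v : Fin n} (huv : (u : ℕ) + 1 = v)
    (hτ : ρ.τ = π.τ * swap u v)
    (hz : ∀ i, ρ.z i = π.z i ∨ (π.τ⁻¹ i : ℕ) = 0 ∨ (ρ.τ⁻¹ i : ℕ) = 0)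
    (h : π.τ u < π.τ v) :
    ρ.pairLength + (if π.z (π.τ v) = 0 then 0 else 2) = π.pairLength + 1 := by
  have hlt : u < v := by rw [Fin.lt_def]; omega
  have := pairLength_add huv hτ hz (π.τ v, π.τ u) h (Or.inr rfl)
  simpa [pairCost, h, hτ, hlt, hlt.not_gt] using this

theorem pairLength_of_gt {π ρ : ColoredPerm r n} {u v : Fin n} (huv : (u : ℕ) + 1 = v)
    (hτ : ρ.τ = π.τ * swap u v)
    (hz : ∀ i, ρ.z i = π.z i ∨ (π.τ⁻¹ i : ℕ) = 0 ∨ (ρ.τ⁻¹ i : ℕ) = 0)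
    (h : π.τ v < π.τ u) :
    ρ.pairLength + 1 = π.pairLength + (if ρ.z (π.τ u) = 0 then 0 else 2) := by
  have hlt : u < v := by rw [Fin.lt_def]; omega
  have := pairLength_add huv hτ hz (π.τ u, π.τ v) h (Or.inl rfl)
  simpa [pairCost, h, hτ, hlt, hlt.not_gt] using this

theorem pairLength_le_add_one {π ρ : ColoredPerm r n} {u v : Fin n} (huv : (u : ℕ) + 1 = v)
    (hτ : ρ.τ = π.τ * swap u v)
    (hz : ∀ i, ρ.z i = π.z i ∨ (π.τ⁻¹ i : ℕ) = 0 ∨ (ρ.τ⁻¹ i : ℕ) = 0) :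
    ρ.pairLength ≤ π.pairLength + 1 := by
  have hne : π.τ u ≠ π.τ v := fun h => by
    have := congrArg Fin.val (π.τ.injective h)
    omega
  rcases lt_or_gt_of_ne hne with h | h
  · have := pairLength_of_lt huv hτ hz h
    omega
  · have := pairLength_of_gt huv hτ hz h
    split_ifs at this <;> omega

theorem s₀_pow (k : ℕ) :
    (s₀ : ColoredPerm r n) ^ k = ⟨fun j => if (j : ℕ) = 0 then (k : ZMod r) else 0, 1⟩ := by
  induction k with
  | zero => ext <;> simp
  | succ k ih =>
    rw [pow_succ, ih]
    ext j
    · by_cases h : (j : ℕ) = 0 <;> simp [s₀, h]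
    · simp [s₀]

/-- The effect of a right multiplication by an element with permutation `swap u v` that adds
`r / 2` to the color of the digit that stands first before or after the multiplication. -/
structure IsSwapStep (π ρ : ColoredPerm r n) (u v : Fin n) : Prop where
  adj : (u : ℕ) + 1 = v
  τ_eq : ρ.τ = π.τ * swap u v
  z_eq : ∀ i, ρ.z i = π.z i ∨
    ρ.z i = π.z i + (r / 2 : ℕ) ∧ ((π.τ⁻¹ i : ℕ) = 0 ∨ (ρ.τ⁻¹ i : ℕ) = 0)

namespace IsSwapStep

variable {π ρ : ColoredPerm r n} {u v : Fin n}

theorem z_eq_or (h : IsSwapStep π ρ u v) (i : Fin n) :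
    ρ.z i = π.z i ∨ (π.τ⁻¹ i : ℕ) = 0 ∨ (ρ.τ⁻¹ i : ℕ) = 0 :=
  (h.z_eq i).imp_right And.right

theorem colorLength_eq (hr : r % 4 = 2) (h : IsSwapStep π ρ u v) :
    ρ.colorLength = π.colorLength :=
  colorLength_eq_of_half hr fun i => (h.z_eq i).imp_right And.left

theorem altLength_le (hr : r % 4 = 2) (h : IsSwapStep π ρ u v) :
    ρ.altLength ≤ π.altLength + 1 := by
  have := pairLength_le_add_one h.adj h.τ_eq h.z_eq_or
  rw [altLength, altLength, h.colorLength_eq hr]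
  omega

theorem altLength_of_lt (hr : r % 4 = 2) (h : IsSwapStep π ρ u v) (hlt : π.τ u < π.τ v)
    (hc : π.z (π.τ v) ≠ 0) : ρ.altLength + 1 = π.altLength := by
  have := pairLength_of_lt h.adj h.τ_eq h.z_eq_or hlt
  rw [if_neg hc] at this
  rw [altLength, altLength, h.colorLength_eq hr]
  omega

theorem altLength_of_gt (hr : r % 4 = 2) (h : IsSwapStep π ρ u v) (hlt : π.τ v < π.τ u)
    (hc : ρ.z (π.τ u) = 0) : ρ.altLength + 1 = π.altLength := by
  have := pairLength_of_gt h.adj h.τ_eq h.z_eq_or hlt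
  rw [if_pos hc] at this
  rw [altLength, altLength, h.colorLength_eq hr]
  omega

end IsSwapStep

end ColoredPerm

/-! ### Action of the generators, descents, and the length in `A_{r,n}` -/

namespace AltColoredPerm

open ColoredPerm

variable {r n : ℕ} (hr : r % 4 = 2)

theorem coe_a_of_eq_zero {i : Fin n} (hi : (i : ℕ) = 0) :
    (a hr i).1 = ⟨fun j => if (j : ℕ) = 0 then 2 else 0, 1⟩ := by
  simp only [a, hi, if_true, s₀_pow, Nat.cast_ofNat]

theorem coe_a_of_ne_zero {u i : Fin n} (hi : (u : ℕ) + 1 = i) :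
    (a hr i).1 = ⟨fun j => if (j : ℕ) = 0 then ((r / 2 : ℕ) : ZMod r) else 0, swap u i⟩ := by
  have h0 : (i : ℕ) ≠ 0 := by omega
  have hu : (⟨(i : ℕ) - 1, lt_of_le_of_lt (Nat.sub_le _ _) i.isLt⟩ : Fin n) = u :=
    Fin.ext (by simp only; omega)
  simp only [a, h0, if_false, s₀_pow, s, hu]
  ext j <;> simp

theorem mul_a_zero_z (π : AltColoredPerm n hr) {i : Fin n} (hi : (i : ℕ) = 0) (j : Fin n) :
    (π * a hr i).1.z j = π.1.z j + if π.1.τ⁻¹ j = i then 2 else 0 := by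
  rw [Subgroup.coe_mul, mul_z, coe_a_of_eq_zero hr hi]
  simp only [Fin.ext_iff, hi]

theorem mul_a_zero_τ (π : AltColoredPerm n hr) {i : Fin n} (hi : (i : ℕ) = 0) :
    (π * a hr i).1.τ = π.1.τ := by
  rw [Subgroup.coe_mul, mul_τ, coe_a_of_eq_zero hr hi, mul_one]

theorem mul_a_z (π : AltColoredPerm n hr) {u i : Fin n} (hi : (u : ℕ) + 1 = i) (j : Fin n) :
    (π * a hr i).1.z j = π.1.z j + if (π.1.τ⁻¹ j : ℕ) = 0 then ((r / 2 : ℕ) : ZMod r) else 0 := by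
  rw [Subgroup.coe_mul, mul_z, coe_a_of_ne_zero hr hi]

theorem mul_a_τ (π : AltColoredPerm n hr) {u i : Fin n} (hi : (u : ℕ) + 1 = i) :
    (π * a hr i).1.τ = π.1.τ * swap u i := by
  rw [Subgroup.coe_mul, mul_τ, coe_a_of_ne_zero hr hi]

theorem mul_a_inv_τ (π : AltColoredPerm n hr) {u i : Fin n} (hi : (u : ℕ) + 1 = i) :
    (π * (a hr i)⁻¹).1.τ = π.1.τ * swap u i := by
  rw [Subgroup.coe_mul, mul_τ, Subgroup.coe_inv, coe_a_of_ne_zero hr hi, inv_τ, swap_inv]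

/-- Unlike `a_i`, the inverse recolors the digit that stands first after the multiplication; the two
differ when `i = 1`. -/
theorem mul_a_inv_z (π : AltColoredPerm n hr) {u i : Fin n} (hi : (u : ℕ) + 1 = i) (j : Fin n) :
    (π * (a hr i)⁻¹).1.z j = π.1.z j +
      if ((π * (a hr i)⁻¹).1.τ⁻¹ j : ℕ) = 0 then ((r / 2 : ℕ) : ZMod r) else 0 := by
  rw [mul_a_inv_τ hr π hi, Subgroup.coe_mul, mul_z, Subgroup.coe_inv, coe_a_of_ne_zero hr hi,
    inv_z, mul_inv_rev, swap_inv, Perm.mul_apply, neg_ite, neg_half_cast hr, neg_zero]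

theorem isSwapStep_mul_a (π : AltColoredPerm n hr) {u i : Fin n} (hi : (u : ℕ) + 1 = i) :
    IsSwapStep π.1 (π * a hr i).1 u i where
  adj := hi
  τ_eq := mul_a_τ hr π hi
  z_eq j := by
    rw [mul_a_z hr π hi]
    split_ifs with h
    · exact Or.inr ⟨rfl, Or.inl h⟩
    · exact Or.inl (add_zero _)

theorem isSwapStep_mul_a_inv (π : AltColoredPerm n hr) {u i : Fin n} (hi : (u : ℕ) + 1 = i) :
    IsSwapStep π.1 (π * (a hr i)⁻¹).1 u i where
  adj := hi
  τ_eq := mul_a_inv_τ hr π hi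
  z_eq j := by
    rw [mul_a_inv_z hr π hi]
    split_ifs with h
    · exact Or.inr ⟨rfl, Or.inr h⟩
    · exact Or.inl (add_zero _)

/-- Multiplication by `a_0` changes the length like the reduced color of the first entry. -/
theorem altLength_mul_a_zero (π : AltColoredPerm n hr) {i : Fin n} (hi : (i : ℕ) = 0) :
    (π * a hr i).1.altLength + oslash r (π.1.z (π.1.τ i)).val =
      π.1.altLength + oslash r (π.1.z (π.1.τ i) + 2).val := by
  have hp : (π * a hr i).1.pairLength = π.1.pairLength := by
    refine pairLength_eq (mul_a_zero_τ hr π hi) fun j => ?_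
    rw [mul_a_zero_z hr π hi]
    split_ifs with h
    · exact Or.inr (h ▸ hi)
    · exact Or.inl (add_zero _)
  have hc := sum_add_eq_of_eq_off (f := fun j => oslash r ((π * a hr i).1.z j).val)
    (g := fun j => oslash r (π.1.z j).val) (π.1.τ i) fun j hj => by
      have : π.1.τ⁻¹ j ≠ i := fun h => hj (Perm.inv_eq_iff_eq.1 h)
      simp only [mul_a_zero_z hr π hi, this, if_false, add_zero]
  rw [mul_a_zero_z hr π hi (π.1.τ i),
    if_pos (show π.1.τ⁻¹ (π.1.τ i) = i from π.1.τ.symm_apply_apply i)] at hc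
  rw [altLength, altLength, hp, colorLength, colorLength]
  omega

theorem altLength_mul_le (π g : AltColoredPerm n hr) (hg : g ∈ generators hr n) :
    (π * g).1.altLength ≤ π.1.altLength + 1 := by
  rcases hg with ⟨i, rfl⟩ | ⟨i, hi, rfl⟩
  · rcases Nat.eq_zero_or_pos i with hi | hi
    · have h1 := altLength_mul_a_zero hr π hi
      have h2 := oslash_val_add_two hr (π.1.z (π.1.τ i))
      omega
    · exact (isSwapStep_mul_a hr π (u := ⟨i - 1, by omega⟩) (Nat.sub_add_cancel hi)).altLength_le hr
  · exact (isSwapStep_mul_a_inv hr π (u := ⟨0, by omega⟩) (by simp [hi])).altLength_le hr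

theorem eq_zero_or_half_of_no_descent {π : AltColoredPerm n hr}
    (h : ∀ g ∈ generators hr n, (π * g⁻¹).1.altLength + 1 ≠ π.1.altLength)
    {i : Fin n} (hi : (i : ℕ) = 0) :
    π.1.z (π.1.τ i) = 0 ∨ π.1.z (π.1.τ i) = (r / 2 : ℕ) := by
  rw [← oslash_val_eq_zero_iff hr]
  by_contra hne
  refine h (a hr i) (Or.inl ⟨i, rfl⟩) ?_
  set ρ := π * (a hr i)⁻¹ with hρ
  -- The inverse of `a_0` need not be a generator, so the step is read from `ρ` to `π`; a
  -- wrap-around would make the reduced color of `π` zero, against `hne`.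
  have hπ : π = ρ * a hr i := by simp [hρ]
  have hz : π.1.z (π.1.τ i) = ρ.1.z (ρ.1.τ i) + 2 := by
    rw [hπ, mul_a_zero_τ hr ρ hi, mul_a_zero_z hr ρ hi]
    simp
  have h1 := altLength_mul_a_zero hr ρ hi
  have h2 := oslash_val_add_two hr (ρ.1.z (ρ.1.τ i))
  rw [hz] at hne
  rw [← hπ] at h1
  omega

/-- A swap is a descent if it moves a larger digit back and leaves it uncolored, or moves a larger
colored digit forward. -/
theorem lt_and_eq_zero_of_no_descent {π : AltColoredPerm n hr}
    (h : ∀ g ∈ generators hr n, (π * g⁻¹).1.altLength + 1 ≠ π.1.altLength)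
    {u i : Fin n} (hi : (u : ℕ) + 1 = i)
    (hu : π.1.z (π.1.τ u) = 0 ∨ (u : ℕ) = 0 ∧ π.1.z (π.1.τ u) = (r / 2 : ℕ)) :
    π.1.τ u < π.1.τ i ∧ π.1.z (π.1.τ i) = 0 := by
  have hs := isSwapStep_mul_a_inv hr π hi
  have hmem : a hr i ∈ generators hr n := Or.inl ⟨i, rfl⟩
  have hne : π.1.τ u ≠ π.1.τ i := fun e => by
    have := congrArg Fin.val (π.1.τ.injective e)
    omega
  have hlt : π.1.τ u < π.1.τ i := by
    refine (lt_or_gt_of_ne hne).resolve_right fun hgt => ?_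
    rcases hu with hu | ⟨hu0, hu⟩
    · refine h _ hmem (hs.altLength_of_gt hr hgt ?_)
      have h0 : (i : ℕ) ≠ 0 := by omega
      rw [mul_a_inv_z hr π hi, mul_a_inv_τ hr π hi, hu]
      simp [h0]
    -- The first digit has color `r/2`, which right multiplication by `a_1` cancels; this is where
    -- the generator `a_1⁻¹` is needed.
    · refine h (a hr i)⁻¹ (Or.inr ⟨i, by omega, rfl⟩) ?_
      rw [inv_inv]
      refine (isSwapStep_mul_a hr π hi).altLength_of_gt hr hgt ?_
      rw [mul_a_z hr π hi, hu, if_pos, two_mul_half_cast hr]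
      rwa [show π.1.τ⁻¹ (π.1.τ u) = u from π.1.τ.symm_apply_apply u]
  refine ⟨hlt, ?_⟩
  by_contra hc
  exact h _ hmem (hs.altLength_of_lt hr hlt hc)

/-- Induction along the positions makes the window increasing and uncolored after its first entry. A
color `r/2` there is excluded by the character, `r/2` being odd. -/
theorem eq_one_of_no_descent {π : AltColoredPerm n hr}
    (h : ∀ g ∈ generators hr n, (π * g⁻¹).1.altLength + 1 ≠ π.1.altLength) : π = 1 := by
  have key : ∀ (k : ℕ) (hk : k < n), π.1.z (π.1.τ ⟨k, hk⟩) = 0 ∨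
      k = 0 ∧ π.1.z (π.1.τ ⟨k, hk⟩) = (r / 2 : ℕ) := by
    intro k
    induction k with
    | zero => exact fun hk => (eq_zero_or_half_of_no_descent hr h rfl).imp_right fun h => ⟨rfl, h⟩
    | succ k ih =>
      exact fun hk => Or.inl (lt_and_eq_zero_of_no_descent hr h rfl (ih (by omega))).2
  have hτ : π.1.τ = 1 := by
    have hmono : StrictMono π.1.τ := by
      rcases n with _ | n
      · exact fun i => i.elim0
      · exact Fin.strictMono_iff_lt_succ.2 fun i =>
          (lt_and_eq_zero_of_no_descent hr h (by simp) (key _ i.castSucc.isLt)).1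
    exact DFunLike.coe_injective ((hmono.range_inj strictMono_id).1
      (by rw [π.1.τ.surjective.range_eq, Set.range_id]))
  simp only [hτ, Perm.one_apply] at key
  have hz : ∀ i, π.1.z i = 0 := by
    intro i
    refine (key i i.isLt).resolve_right ?_
    rintro ⟨hi, hzi⟩
    have hodd : Odd (r / 2) := Nat.odd_iff.2 (by omega)
    have hπ : altChar n (even_of_mod_four hr) π.1 = 1 := π.2
    rw [altChar_apply, hτ, Perm.sign_one, mul_one, Finset.prod_eq_single i _ (by simp), hzi,
      neg_one_pow_val_natCast (even_of_mod_four hr), hodd.neg_one_pow] at hπ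
    · exact absurd hπ (by decide)
    · intro j _ hj
      have hj0 : (j : ℕ) ≠ 0 := fun h0 => hj (Fin.ext (h0.trans hi.symm))
      rw [(key j j.isLt).resolve_right fun h => hj0 h.1]
      simp
  exact Subtype.ext (ColoredPerm.ext (funext hz) hτ)

theorem exists_descent (π : AltColoredPerm n hr) (hπ : π ≠ 1) :
    ∃ g ∈ generators hr n, (π * g⁻¹).1.altLength + 1 = π.1.altLength := by
  by_contra! h
  exact hπ (eq_one_of_no_descent hr h)

/-- The closed formula for the length function `ℓ_𝒜`. -/
theorem length_eq_altLength (π : AltColoredPerm n hr) : length hr π = π.1.altLength :=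
  wordLength_eq_of_descent (L := fun π : AltColoredPerm n hr => π.1.altLength) altLength_one
    (altLength_mul_le hr) (exists_descent hr) π

theorem closure_generators : Submonoid.closure (generators hr n) = ⊤ :=
  closure_eq_top_of_descent (L := fun π : AltColoredPerm n hr => π.1.altLength) altLength_one
    (exists_descent hr)

/-! ### The composite of the covering map and its section -/

theorem sec_p_τ (π : AltColoredPerm n hr) : (sec hr (p hr π)).1.τ = π.1.τ := rfl

theorem val_p_z (π : AltColoredPerm n hr) (i : Fin n) :
    ((p hr π).z i).val = oslash r (π.1.z i).val :=
  ZMod.val_cast_of_lt (oslash_lt hr _)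

theorem sec_p_z (π : AltColoredPerm n hr) (i : Fin n) :
    (sec hr (p hr π)).1.z i = ((2 * oslash r (π.1.z i).val : ℕ) : ZMod r) ∨ (i : ℕ) = 0 ∧
      (sec hr (p hr π)).1.z i =
        ((2 * oslash r (π.1.z i).val : ℕ) : ZMod r) + (r / 2 : ℕ) := by
  simp only [sec, sectionAux, val_p_z]
  split_ifs with h
  · exact Or.inr ⟨h.1, Nat.cast_add _ _⟩
  · exact Or.inl (by rw [add_zero])

theorem oslash_sec_p (π : AltColoredPerm n hr) (i : Fin n) :
    oslash r ((sec hr (p hr π)).1.z i).val = oslash r (π.1.z i).val := by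
  have h := oslash_two_mul hr (oslash_lt hr (π.1.z i).val)
  rcases sec_p_z hr π i with h' | ⟨-, h'⟩
  · rw [h', h]
  · rw [h', oslash_val_add_half hr, h]

theorem sec_p_z_eq_zero_iff (π : AltColoredPerm n hr) {i : Fin n} (hi : (i : ℕ) ≠ 0) :
    (sec hr (p hr π)).1.z i = 0 ↔ π.1.z i = 0 ∨ π.1.z i = (r / 2 : ℕ) := by
  rw [← oslash_val_eq_zero_iff hr]
  constructor
  · intro h
    rw [← oslash_sec_p, h]
    simp [oslash]
  · intro h
    rw [(sec_p_z hr π i).resolve_right fun h' => hi h'.1, h]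
    simp

theorem half_cast_ne_zero {r : ℕ} (hr : r % 4 = 2) : ((r / 2 : ℕ) : ZMod r) ≠ 0 := by
  rw [Ne, ZMod.natCast_eq_zero_iff]
  exact fun h => absurd (Nat.le_of_dvd (by omega) h) (by omega)

/-- The costs differ only if `q.1` has color `r/2` and stands after `q.2`: then they are `2` and
`0`. -/
theorem pairCost_add (π : AltColoredPerm n hr) (q : Fin n × Fin n) :
    π.1.pairCost q + 2 * (if q ∈ Tinv hr π then 1 else 0) =
      (sec hr (p hr π)).1.pairCost q +
        2 * (if q.1 ∈ halfColored hr π ∧ q.2 < q.1 then 1 else 0) := by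
  by_cases hlt : q.2 < q.1
  · have hne := half_cast_ne_zero hr
    -- The larger digit is not digit `1`, so the parity correction of the section is invisible.
    have h0 : (q.1 : ℕ) ≠ 0 := by
      rw [Fin.lt_def] at hlt
      omega
    simp only [Tinv, halfColored, Finset.mem_filter, Finset.mem_univ, true_and, pairCost, hlt,
      if_true, and_true, sec_p_τ, sec_p_z_eq_zero_iff hr π h0]
    by_cases h1 : π.1.z q.1 = (r / 2 : ℕ)
    · by_cases h2 : π.1.τ⁻¹ q.1 < π.1.τ⁻¹ q.2 <;>
        simp only [h1, h2, hne, and_self, and_false, or_true, if_true, if_false]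
    · simp [h1]
  · simp [pairCost, Tinv, hlt]

theorem pairLength_add_tinv (π : AltColoredPerm n hr) :
    π.1.pairLength + 2 * tinv hr π =
      (sec hr (p hr π)).1.pairLength + 2 * ∑ i ∈ halfColored hr π, (i : ℕ) := by
  have h1 : tinv hr π = ∑ q, if q ∈ Tinv hr π then 1 else 0 := by
    simp [tinv]
  -- Exactly `i` elements of `Fin n` lie below `i`.
  have h2 : ∑ i ∈ halfColored hr π, (i : ℕ) =
      ∑ q : Fin n × Fin n, if q.1 ∈ halfColored hr π ∧ q.2 < q.1 then 1 else 0 := by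
    rw [Fintype.sum_prod_type, ← Finset.sum_filter_add_sum_filter_not Finset.univ
      (· ∈ halfColored hr π), Finset.filter_univ_mem, Finset.sum_congr rfl fun i hi => ?_,
      Finset.sum_eq_zero (s := Finset.univ.filter _), add_zero]
    · intro i hi
      simp [(Finset.mem_filter.1 hi).2]
    · simp only [hi, true_and, Finset.sum_boole, Nat.cast_id, Finset.filter_gt_eq_Iio,
        Fin.card_Iio]
  rw [h1, h2, pairLength, pairLength, Finset.mul_sum, Finset.mul_sum, ← Finset.sum_add_distrib,
    ← Finset.sum_add_distrib]
  exact Finset.sum_congr rfl fun q _ => pairCost_add hr π q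

end AltColoredPerm

/-- The digit `i + 1` of `{1, …, n}` is `i : Fin n`, so the summand `i - 1` of the digit `i`
reads `(i : ℤ)`. The first conjunct says that the minimum defining `ℓ_𝒜` is over a non-empty
set of words for every element of the group. -/
theorem mainTheorem8 (r n : ℕ) (hr : r % 4 = 2) (hn : 0 < n) :
    Submonoid.closure (AltColoredPerm.generators hr n) = ⊤ ∧
    ∀ π : AltColoredPerm n hr,
      AltColoredPerm.fibralLength hr π =
        2 * (∑ i ∈ AltColoredPerm.halfColored hr π, ((i : ℕ) : ℤ))
          - 2 * (AltColoredPerm.tinv hr π : ℤ) := by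
  refine ⟨AltColoredPerm.closure_generators hr, fun π => ?_⟩
  have hc : (AltColoredPerm.sec hr (AltColoredPerm.p hr π)).1.colorLength = π.1.colorLength :=
    Finset.sum_congr rfl fun i _ => AltColoredPerm.oslash_sec_p hr π i
  have hp := AltColoredPerm.pairLength_add_tinv hr π
  rw [AltColoredPerm.fibralLength, AltColoredPerm.length_eq_altLength,
    AltColoredPerm.length_eq_altLength, ColoredPerm.altLength, ColoredPerm.altLength, hc]
  zify at hp
  push_cast
  linarith
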